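/- Let $[n]=\{1,\dots,n\}$ and let $[r]$ be a set of $r$ colors. An $r$-template of order $n$ is a function $P\colon [n]\to 2^{[r]}$; $P_1$ is a subtemplate of $P_2$ if $P_1(x)\subseteq P_2(x)$ for every $x\in[n]$. A template $P$ is a rainbow 3-AP if there are $a,b,c\in[n]$ with $a+c=2b$ such that $|P(a)|=|P(b)|=|P(c)|=1$, the sets $P(a),P(b),P(c)$ are pairwise distinct, and $P(x)=\emptyset$ for all $x\in[n]\setminus\{a,b,c\}$. A template is rainbow 3-AP-free if none of its subtemplates is a rainbow 3-AP. Let $R(P)$ be the number of subtemplates of $P$ that are rainbow 3-APs, and let $f(n)$ be the number of 3-term arithmetic progressions with nonzero common difference in $[n]$ (a progression and its reversal being counted once). Theorem. For every integer $r\ge 3$ there is a constant $c=c(r)>0$ such that for every integer $n\ge 1$ there is a collection $\mathcal{C}$ of $r$-templates of order $n$ with the following properties: (i) every rainbow 3-AP-free $r$-template of order $n$ is a subtemplate of some $P\in\mathcal{C}$; (ii) $R(P)\le n^{-1/3}f(n)$ for every $P\in\mathcal{C}$; (iii) $\log_2|\mathcal{C}|\le c\,n^{2/3}(\log_2 n)^2$.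 -/

import Mathlib

namespace RainbowAP

/-- The integer interval `[n] = {1, …, n}`, as a type. -/
abbrev Interval (n : ℕ) : Type := {x : ℕ // x ∈ Finset.Icc 1 n}

/-- An `r`-template of order `n`: a palette `P x ⊆ [r]` for every `x ∈ [n]`.
The set of `r` colors is `Fin r`. -/
abbrev Template (r n : ℕ) : Type := Interval n → Finset (Fin r)

/-- `P₁` is a subtemplate of `P₂`. -/
def IsSubtemplate {r n : ℕ} (P₁ P₂ : Template r n) : Prop :=
  ∀ x : Interval n, P₁ x ⊆ P₂ x

/-- The template `P` is a rainbow 3-AP: it consists of exactly one color at each of the three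
terms of a 3-AP `a, b, c`, these colors being pairwise distinct, and of no color elsewhere.
(The distinctness of the palettes forces `a, b, c` to be distinct, so the 3-AP is nontrivial.) -/
def IsRainbow3AP {r n : ℕ} (P : Template r n) : Prop :=
  ∃ a b c : Interval n, (a : ℕ) + (c : ℕ) = 2 * (b : ℕ) ∧
    (P a).card = 1 ∧ (P b).card = 1 ∧ (P c).card = 1 ∧
    (∀ x : Interval n, x ≠ a → x ≠ b → x ≠ c → (P x).card = 0) ∧
    P a ≠ P b ∧ P b ≠ P c ∧ P a ≠ P c

/-- No subtemplate of `P` is a rainbow 3-AP. -/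
def IsRainbow3APFree {r n : ℕ} (P : Template r n) : Prop :=
  ∀ Q : Template r n, IsSubtemplate Q P → ¬ IsRainbow3AP Q

/-- `R(P)`: the number of subtemplates of `P` that are rainbow 3-APs. -/
noncomputable def numRainbow3AP {r n : ℕ} (P : Template r n) : ℕ :=
  Set.ncard {Q : Template r n | IsSubtemplate Q P ∧ IsRainbow3AP Q}

/-- `f(n)`: the number of (nontrivial) 3-APs in `[n]`, each listed once, in increasing order. -/
def num3AP (n : ℕ) : ℕ :=
  ((Finset.univ : Finset (Interval n × Interval n × Interval n)).filter
    (fun t => (t.1 : ℕ) < (t.2.1 : ℕ) ∧ (t.2.1 : ℕ) < (t.2.2 : ℕ) ∧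
      (t.1 : ℕ) + (t.2.2 : ℕ) = 2 * (t.2.1 : ℕ))).card

end RainbowAP

/-! Take the pairs (position, color) as vertices and the rainbow 3-APs as edges of a 3-uniform
hypergraph. Templates are vertex sets, rainbow 3-AP-free templates are independent sets, and two
vertices lie in at most K = 3r common edges.

Containers come from an algorithm that maintains S ⊆ I ⊆ C for an independent set I, with
fingerprint S and container C. If a vertex of I has link degree above B, its neighbors in the links
of S avoid I and are deleted, more than B/K at a time. Otherwise C is trimmed to link degree at most
B, and a vertex of I \ S of degree at least D in C joins S. A potential (`potential_mono`) bounds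
the insertions by A ≈ 3(B + K)|V|/D, and the prunings number at most P ≈ K|V|/B. When no step
applies, I lies in S together with vertices of degree below D, which span few edges
(`sum_finalContainer_le`).

Here |V| = rn. Taking B of order n^(1/3) and D, A, P of order n^(2/3) gives (ii), and the A + P
recorded vertices give (iii). -/

namespace HypergraphContainer

open Finset

/-! ### Link degrees and double counting -/

variable {V : Type*}

/-- The degree of `x` into `C` in the graph formed by the links of the vertices in `S`. -/
def linkDegree (h : V → V → V → ℕ) (S C : Finset V) (x : V) : ℕ :=
  ∑ w ∈ C, ∑ s ∈ S, h s x w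

/-- The number of ordered edges at `v` inside `C`. -/
def degreeIn (h : V → V → V → ℕ) (C : Finset V) (v : V) : ℕ :=
  ∑ x ∈ C, ∑ w ∈ C, h v x w

theorem sum_degreeIn (h : V → V → V → ℕ) (S C : Finset V) :
    ∑ s ∈ S, degreeIn h C s = ∑ x ∈ C, linkDegree h S C x := by
  unfold degreeIn linkDegree
  rw [sum_comm]
  exact sum_congr rfl fun x _ => sum_comm

theorem linkDegree_mono (h : V → V → V → ℕ) (S : Finset V) {C C' : Finset V} (hC : C' ⊆ C)
    (x : V) : linkDegree h S C' x ≤ linkDegree h S C x :=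
  sum_le_sum_of_subset hC

theorem sum_sum_le_of_subset [DecidableEq V] (G : V → V → ℕ) (hG : ∀ x y, G x y = G y x) {C' C : Finset V}
    (hC : C' ⊆ C) :
    ∑ x ∈ C, ∑ w ∈ C, G x w ≤
      ∑ x ∈ C', ∑ w ∈ C', G x w + 2 * ∑ x ∈ C \ C', ∑ w ∈ C, G x w := by
  have h1 : ∀ f : V → ℕ, ∑ x ∈ C, f x = ∑ x ∈ C \ C', f x + ∑ x ∈ C', f x :=
    fun f => (sum_sdiff hC).symm
  have h2 : ∑ x ∈ C', ∑ w ∈ C \ C', G x w ≤ ∑ x ∈ C \ C', ∑ w ∈ C, G x w := by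
    rw [sum_comm]
    refine sum_le_sum fun x _ => ?_
    calc ∑ w ∈ C', G w x = ∑ w ∈ C', G x w := sum_congr rfl fun w _ => hG w x
      _ ≤ _ := sum_le_sum_of_subset hC
  have h3 : ∑ x ∈ C', ∑ w ∈ C, G x w =
      ∑ x ∈ C', ∑ w ∈ C \ C', G x w + ∑ x ∈ C', ∑ w ∈ C', G x w := by
    rw [← sum_add_distrib]
    exact sum_congr rfl fun x _ => h1 _
  rw [h1 fun x => ∑ w ∈ C, G x w, h3]
  omega

/-! ### The container algorithm and its potential -/

variable [Fintype V] [DecidableEq V]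

/-- The vertices of `C` whose link degree is at most `B`. -/
def trim (h : V → V → V → ℕ) (B : ℕ) (S C : Finset V) : Finset V :=
  {x ∈ C | linkDegree h S C x ≤ B}

/-- Remove from `C` the neighbors of `u` in the graph formed by the links of `S`. -/
def prune (h : V → V → V → ℕ) (S C : Finset V) (u : V) : Finset V :=
  {w ∈ C | ∑ s ∈ S, h s u w = 0}

/-- The pairs (fingerprint, container) reached by at most `j` steps, each of which either adds a
vertex to the fingerprint after trimming the container, or prunes the container. -/
def reach (h : V → V → V → ℕ) (B : ℕ) : ℕ → Finset (Finset V × Finset V)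
  | 0 => {(∅, univ)}
  | j + 1 => reach h B j ∪
      ((reach h B j ×ˢ univ).image (fun p : (Finset V × Finset V) × V =>
        (insert p.2 p.1.1, trim h B p.1.1 p.1.2)) ∪
      (reach h B j ×ˢ univ).image (fun p : (Finset V × Finset V) × V =>
        (p.1.1, prune h p.1.1 p.1.2 p.2)))

/-- The container read off from a pair (fingerprint, container). -/
def finalContainer (h : V → V → V → ℕ) (B D : ℕ) (p : Finset V × Finset V) : Finset V :=
  {v ∈ trim h B p.1 p.2 | degreeIn h (trim h B p.1 p.2) v < D} ∪ p.1

/-- A step is given by its kind and one vertex, or is skipped: 2|V| + 1 options. Since runs are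
counted, pruning vertices need not enter the fingerprint. -/
theorem card_reach_le (h : V → V → V → ℕ) (B j : ℕ) :
    (reach h B j).card ≤ (2 * Fintype.card V + 1) ^ j := by
  induction j with
  | zero => simp [reach]
  | succ j ih =>
    have h1 : (reach h B (j + 1)).card ≤ (reach h B j).card +
        ((reach h B j).card * Fintype.card V + (reach h B j).card * Fintype.card V) := by
      rw [reach]
      refine (card_union_le _ _).trans (Nat.add_le_add_left ((card_union_le _ _).trans ?_) _)
      refine add_le_add (card_image_le.trans ?_) (card_image_le.trans ?_) <;>
        rw [card_product, card_univ]
    calc _ ≤ (reach h B j).card * (2 * Fintype.card V + 1) := by linarith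
      _ ≤ _ := by rw [pow_succ]; exact Nat.mul_le_mul_right _ ih

theorem reach_mono (h : V → V → V → ℕ) (B : ℕ) : Monotone (reach h B) :=
  monotone_nat_of_le_succ fun j => by
    rw [reach]
    exact subset_union_left

/-- Shrinking the container does not decrease the potential. -/
theorem potential_mono (h : V → V → V → ℕ) (hs : ∀ x y z, h x y z = h x z y) {S C C' : Finset V}
    {M : ℕ} (hC : C' ⊆ C) (hM : ∀ x ∈ C, linkDegree h S C x ≤ M) :
    ∑ s ∈ S, degreeIn h C s + 2 * M * Cᶜ.card ≤
      ∑ s ∈ S, degreeIn h C' s + 2 * M * C'ᶜ.card := by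
  -- Deleting a vertex loses its row and its column in the link graph, each of weight at most M;
  -- hence the rate 2M.
  have h1 := sum_sum_le_of_subset (fun x w => ∑ s ∈ S, h s x w)
    (fun x y => sum_congr rfl fun s _ => hs s x y) hC
  have h2 : ∑ x ∈ C \ C', ∑ w ∈ C, ∑ s ∈ S, h s x w ≤ (C \ C').card * M := by
    rw [← smul_eq_mul]
    exact sum_le_card_nsmul _ _ _ fun x hx => hM x (sdiff_subset hx)
  have h3 : C'ᶜ.card = Cᶜ.card + (C \ C').card := by
    have := card_sdiff_add_card_eq_card hC
    have := card_add_card_compl C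
    have := card_add_card_compl C'
    omega
  rw [sum_degreeIn, sum_degreeIn, h3]
  unfold linkDegree
  nlinarith

/-- The invariant of the algorithm that builds the container of `I`. -/
structure Invariant (h : V → V → V → ℕ) (I : Finset V) (K B D j : ℕ)
    (p : Finset V × Finset V) : Prop where
  mem_reach : p ∈ reach h B j
  fingerprint_subset : p.1 ⊆ I
  subset_container : I ⊆ p.2
  linkDegree_le : ∀ x ∈ p.2, linkDegree h p.1 p.2 x ≤ B + K
  mul_card_le : D * p.1.card ≤ ∑ s ∈ p.1, degreeIn h p.2 s + 2 * (B + K) * p.2ᶜ.card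
  mul_le : B * j ≤ B * p.1.card + K * p.2ᶜ.card

variable {h : V → V → V → ℕ} {I : Finset V} {K B D j : ℕ} {p : Finset V × Finset V}

/-- The degrees of S in C sum to the link degrees over C, at most (B + K)|C|. Deleted vertices
account for 2(B + K) each, so the potential is at most 3(B + K)|V|. -/
theorem Invariant.card_le (hp : Invariant h I K B D j p) {A : ℕ} (hD : 0 < D)
    (hA : 3 * (B + K) * Fintype.card V ≤ D * A) : p.1.card ≤ A := by
  have h1 : ∑ s ∈ p.1, degreeIn h p.2 s ≤ p.2.card * (B + K) := by
    rw [sum_degreeIn, ← smul_eq_mul]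
    exact sum_le_card_nsmul _ _ _ hp.linkDegree_le
  have h2 := hp.mul_card_le
  have h3 := card_add_card_compl p.2
  refine Nat.le_of_mul_le_mul_left ?_ hD
  calc D * p.1.card ≤ 3 * (B + K) * (p.2.card + p.2ᶜ.card) := by nlinarith
    _ ≤ _ := by rw [h3]; exact hA

/-- Each insertion enlarges S by one and each pruning deletes more than B/K vertices; `mul_le`
records this. -/
theorem Invariant.steps_le (hp : Invariant h I K B D j p) {A P : ℕ} (hD : 0 < D) (hB : 0 < B)
    (hA : 3 * (B + K) * Fintype.card V ≤ D * A) (hP : K * Fintype.card V ≤ B * P) :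
    j ≤ A + P := by
  have h1 := hp.card_le hD hA
  have h2 := hp.mul_le
  have h3 : K * p.2ᶜ.card ≤ K * Fintype.card V := Nat.mul_le_mul_left _ (card_le_univ _)
  refine Nat.le_of_mul_le_mul_left ?_ hB
  nlinarith

theorem Invariant.exists_prune (hs : ∀ x y z, h x y z = h x z y) (hs' : ∀ x y z, h x y z = h y x z)
    (hK : ∀ x y, ∑ z, h x y z ≤ K) (hI : ∀ x ∈ I, ∀ y ∈ I, ∀ z ∈ I, h x y z = 0)
    (hp : Invariant h I K B D j p) {u : V} (hu : u ∈ I) (hg : B < linkDegree h p.1 p.2 u) :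
    Invariant h I K B D (j + 1) (p.1, prune h p.1 p.2 u) := by
  have hsub : prune h p.1 p.2 u ⊆ p.2 := filter_subset _ _
  refine ⟨?_, hp.fingerprint_subset, ?_, ?_, ?_, ?_⟩
  · rw [reach]
    refine mem_union_right _ (mem_union_right _ (mem_image.2 ⟨(p, u), ?_, rfl⟩))
    exact mem_product.2 ⟨hp.mem_reach, mem_univ _⟩
  · intro w hw
    exact mem_filter.2 ⟨hp.subset_container hw, sum_eq_zero fun s hs =>
      hI s (hp.fingerprint_subset hs) u hu w hw⟩
  · exact fun x hx => (linkDegree_mono h _ hsub x).trans (hp.linkDegree_le x (hsub hx))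
  · exact hp.mul_card_le.trans (potential_mono h hs hsub hp.linkDegree_le)
  -- The deleted vertices carry the whole link degree of u, each at most the codegree K.
  · have h1 : linkDegree h p.1 p.2 u ≤ (p.2 \ prune h p.1 p.2 u).card * K := by
      unfold linkDegree
      rw [← sum_sdiff hsub, ← smul_eq_mul, sum_eq_zero (s := prune h p.1 p.2 u), add_zero]
      · refine sum_le_card_nsmul _ _ _ fun w _ => ?_
        calc ∑ s ∈ p.1, h s u w ≤ ∑ s, h s u w := sum_le_sum_of_subset (subset_univ _)
          _ = ∑ s, h u w s := sum_congr rfl fun s _ => by rw [hs' s u w, hs u s w]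
          _ ≤ K := hK u w
      · exact fun w hw => (mem_filter.1 hw).2
    have h3 : (prune h p.1 p.2 u)ᶜ.card = p.2ᶜ.card + (p.2 \ prune h p.1 p.2 u).card := by
      have := card_sdiff_add_card_eq_card hsub
      have := card_add_card_compl p.2
      have := card_add_card_compl (prune h p.1 p.2 u)
      omega
    have h4 := hp.mul_le
    simp only [h3]
    nlinarith

theorem Invariant.exists_insert (hs : ∀ x y z, h x y z = h x z y)
    (hK : ∀ x y, ∑ z, h x y z ≤ K)
    (hp : Invariant h I K B D j p) (hg : ∀ u ∈ I, linkDegree h p.1 p.2 u ≤ B) {v : V}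
    (hv : v ∈ I) (hv' : v ∉ p.1) (hd : D ≤ degreeIn h (trim h B p.1 p.2) v) :
    Invariant h I K B D (j + 1) (insert v p.1, trim h B p.1 p.2) := by
  have hsub : trim h B p.1 p.2 ⊆ p.2 := filter_subset _ _
  have hcard : (trim h B p.1 p.2)ᶜ.card ≥ p.2ᶜ.card := card_le_card (compl_subset_compl.2 hsub)
  refine ⟨?_, insert_subset hv hp.fingerprint_subset, ?_, ?_, ?_, ?_⟩
  · rw [reach]
    refine mem_union_right _ (mem_union_left _ (mem_image.2 ⟨(p, v), ?_, rfl⟩))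
    exact mem_product.2 ⟨hp.mem_reach, mem_univ _⟩
  · exact fun w hw => mem_filter.2 ⟨hp.subset_container hw, hg w hw⟩
  · intro x hx
    have h1 : linkDegree h (insert v p.1) (trim h B p.1 p.2) x =
        ∑ w ∈ trim h B p.1 p.2, h v x w + linkDegree h p.1 (trim h B p.1 p.2) x := by
      unfold linkDegree
      rw [← sum_add_distrib]
      exact sum_congr rfl fun w _ => sum_insert hv'
    have h2 : ∑ w ∈ trim h B p.1 p.2, h v x w ≤ K :=
      (sum_le_sum_of_subset (subset_univ _)).trans (hK v x)
    have h3 := (linkDegree_mono h p.1 hsub x).trans (mem_filter.1 hx).2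
    simp only [h1]
    omega
  · have h1 := hp.mul_card_le.trans (potential_mono h hs hsub hp.linkDegree_le)
    simp only [card_insert_of_notMem hv', sum_insert hv']
    nlinarith
  · have := hp.mul_le
    simp only [card_insert_of_notMem hv']
    nlinarith

/-! ### The container theorem -/

theorem exists_reach_finalContainer (hs : ∀ x y z, h x y z = h x z y)
    (hs' : ∀ x y z, h x y z = h y x z) (hK : ∀ x y, ∑ z, h x y z ≤ K)
    (hI : ∀ x ∈ I, ∀ y ∈ I, ∀ z ∈ I, h x y z = 0) {A P : ℕ} (hD : 0 < D) (hB : 0 < B)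
    (hA : 3 * (B + K) * Fintype.card V ≤ D * A) (hP : K * Fintype.card V ≤ B * P) :
    ∃ p ∈ reach h B (A + P), p.1.card ≤ A ∧ I ⊆ finalContainer h B D p := by
  classical
  have h0 : ∃ p, Invariant h I K B D 0 p :=
    ⟨(∅, univ), by simp [reach], by simp, by simp, by simp [linkDegree], by simp, by simp⟩
  -- Run lengths are bounded, so there is a last valid state, at which neither kind of step applies.
  obtain ⟨j, ⟨p, hp⟩, hmax⟩ : ∃ j, (∃ p, Invariant h I K B D j p) ∧
      ¬ ∃ p, Invariant h I K B D (j + 1) p := by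
    by_contra! hcon
    have hall : ∀ j, ∃ p, Invariant h I K B D j p := by
      intro j
      induction j with
      | zero => exact h0
      | succ j ih => exact hcon j ih
    obtain ⟨p, hp⟩ := hall (A + P + 1)
    have := hp.steps_le hD hB hA hP
    omega
  refine ⟨p, reach_mono h B (hp.steps_le hD hB hA hP) hp.mem_reach, hp.card_le hD hA, ?_⟩
  have hg : ∀ u ∈ I, linkDegree h p.1 p.2 u ≤ B := by
    intro u hu
    by_contra! hlt
    exact hmax ⟨_, hp.exists_prune hs hs' hK hI hu hlt⟩
  intro v hv
  by_cases hv' : v ∈ p.1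
  · exact mem_union_right _ hv'
  · refine mem_union_left _ (mem_filter.2
      ⟨mem_filter.2 ⟨hp.subset_container hv, hg v hv⟩, ?_⟩)
    by_contra! hd
    exact hmax ⟨_, hp.exists_insert hs hK hg hv hv' hd⟩

theorem sum_finalContainer_le (hs : ∀ x y z, h x y z = h x z y)
    (hs' : ∀ x y z, h x y z = h y x z) (hK : ∀ x y, ∑ z, h x y z ≤ K) {A : ℕ}
    (hA : p.1.card ≤ A) :
    ∑ v ∈ finalContainer h B D p, degreeIn h (finalContainer h B D p) v ≤
      Fintype.card V * D + 3 * A * K * Fintype.card V := by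
  set C := trim h B p.1 p.2 with hC
  set Lo : Finset V := {v ∈ C | degreeIn h C v < D} with hLo
  have hLoC : Lo ⊆ C := filter_subset _ _
  have hF : finalContainer h B D p = Lo ∪ p.1 := rfl
  have hsplit : ∀ f : V → ℕ, ∑ x ∈ Lo ∪ p.1, f x ≤ ∑ x ∈ Lo, f x + ∑ x ∈ p.1, f x := by
    intro f
    rw [← sum_union_inter]
    exact Nat.le_add_right _ _
  have huniv : ∀ x, ∑ y, ∑ z, h x y z ≤ K * Fintype.card V := by
    intro x
    rw [mul_comm, ← smul_eq_mul, ← card_univ]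
    exact sum_le_card_nsmul _ _ _ fun y _ => hK x y
  have hS : ∀ f : V → ℕ, (∀ x, f x ≤ K * Fintype.card V) →
      ∑ x ∈ p.1, f x ≤ A * (K * Fintype.card V) := by
    intro f hf
    calc ∑ x ∈ p.1, f x ≤ p.1.card • (K * Fintype.card V) :=
          sum_le_card_nsmul _ _ _ fun x _ => hf x
      _ ≤ _ := Nat.mul_le_mul_right _ hA
  have hin : ∀ (x : V) (s t : Finset V), ∑ y ∈ s, ∑ z ∈ t, h x y z ≤ K * Fintype.card V := by
    intro x s t
    refine le_trans ?_ (huniv x)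
    refine (sum_le_sum fun y _ => sum_le_sum_of_subset (subset_univ t)).trans ?_
    exact sum_le_sum_of_subset (subset_univ s)
  rw [hF]
  -- Triples meeting S are discarded one coordinate at a time, at a cost of at most A · K|V| per
  -- coordinate.
  have h1 : ∑ x ∈ Lo ∪ p.1, degreeIn h (Lo ∪ p.1) x ≤
      ∑ x ∈ Lo, degreeIn h (Lo ∪ p.1) x + A * (K * Fintype.card V) :=
    (hsplit _).trans (Nat.add_le_add_left (hS _ fun x => hin x _ _) _)
  have h2 : ∑ x ∈ Lo, degreeIn h (Lo ∪ p.1) x ≤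
      ∑ x ∈ Lo, ∑ y ∈ Lo, ∑ z ∈ Lo ∪ p.1, h x y z + A * (K * Fintype.card V) := by
    unfold degreeIn
    refine (sum_le_sum fun x _ => hsplit _).trans ?_
    rw [sum_add_distrib]
    refine Nat.add_le_add_left ?_ _
    rw [sum_comm]
    refine hS _ fun y => ?_
    rw [sum_congr rfl fun x _ => sum_congr rfl fun z _ => hs' x y z]
    exact hin y _ _
  have h3 : ∑ x ∈ Lo, ∑ y ∈ Lo, ∑ z ∈ Lo ∪ p.1, h x y z ≤
      ∑ x ∈ Lo, ∑ y ∈ Lo, ∑ z ∈ Lo, h x y z + A * (K * Fintype.card V) := by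
    refine (sum_le_sum fun x _ => sum_le_sum fun y _ => hsplit _).trans ?_
    simp_rw [sum_add_distrib]
    refine Nat.add_le_add_left ?_ _
    rw [sum_congr rfl fun x _ => sum_comm, sum_comm]
    refine hS _ fun z => ?_
    rw [sum_congr rfl fun x _ => sum_congr rfl fun y _ => (hs x y z).trans (hs' x z y)]
    exact hin z _ _
  have h4 : ∑ x ∈ Lo, ∑ y ∈ Lo, ∑ z ∈ Lo, h x y z ≤ Fintype.card V * D := by
    calc _ ≤ Lo.card • D := by
          refine sum_le_card_nsmul _ _ _ fun x hx => ?_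
          refine le_trans ?_ (mem_filter.1 hx).2.le
          exact (sum_le_sum fun y _ => sum_le_sum_of_subset hLoC).trans
            (sum_le_sum_of_subset hLoC)
      _ ≤ _ := Nat.mul_le_mul_right _ (card_le_univ _)
  nlinarith

/-- A container theorem for weighted 3-uniform hypergraphs with bounded codegrees. -/
theorem exists_containers (hs : ∀ x y z, h x y z = h x z y)
    (hs' : ∀ x y z, h x y z = h y x z) (hK : ∀ x y, ∑ z, h x y z ≤ K) {A P : ℕ} (hD : 0 < D)
    (hB : 0 < B) (hA : 3 * (B + K) * Fintype.card V ≤ D * A)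
    (hP : K * Fintype.card V ≤ B * P) :
    ∃ 𝓕 : Finset (Finset V), 𝓕.card ≤ (2 * Fintype.card V + 1) ^ (A + P) ∧
      (∀ I : Finset V, (∀ x ∈ I, ∀ y ∈ I, ∀ z ∈ I, h x y z = 0) → ∃ F ∈ 𝓕, I ⊆ F) ∧
      ∀ F ∈ 𝓕, ∑ x ∈ F, ∑ y ∈ F, ∑ z ∈ F, h x y z ≤
        Fintype.card V * D + 3 * A * K * Fintype.card V := by
  classical
  refine ⟨{p ∈ reach h B (A + P) | p.1.card ≤ A}.image (finalContainer h B D), ?_, ?_, ?_⟩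
  · exact card_image_le.trans ((card_filter_le _ _).trans (card_reach_le h B _))
  · intro I hI
    obtain ⟨p, hp, hpA, hpI⟩ := exists_reach_finalContainer hs hs' hK hI hD hB hA hP
    exact ⟨_, mem_image_of_mem _ (mem_filter.2 ⟨hp, hpA⟩), hpI⟩
  · intro F hF
    obtain ⟨p, hp, rfl⟩ := mem_image.1 hF
    exact sum_finalContainer_le hs hs' hK (mem_filter.1 hp).2

end HypergraphContainer

/-! ### The hypergraph of rainbow 3-APs -/

namespace RainbowAP

open Finset

variable {r n : ℕ}

/-- The template whose palettes are the fibers of a set of (position, color) pairs. -/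
def ofFinset (F : Finset (Interval n × Fin r)) : Template r n :=
  fun x => {i | (x, i) ∈ F}

/-- The set of (position, color) pairs of a template. -/
def toFinset (P : Template r n) : Finset (Interval n × Fin r) :=
  {p | p.2 ∈ P p.1}

theorem mem_ofFinset {F : Finset (Interval n × Fin r)} {x : Interval n} {i : Fin r} :
    i ∈ ofFinset F x ↔ (x, i) ∈ F := by
  simp [ofFinset]

theorem isSubtemplate_ofFinset {P : Template r n} {F : Finset (Interval n × Fin r)} :
    IsSubtemplate P (ofFinset F) ↔ toFinset P ⊆ F := by
  constructor
  · intro hP p hp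
    exact mem_ofFinset.1 (hP p.1 (by simpa [toFinset] using hp))
  · intro hP x i hi
    exact mem_ofFinset.2 (hP (by simpa [toFinset] using hi))

theorem ofFinset_isSubtemplate {P : Template r n} {F : Finset (Interval n × Fin r)}
    (hF : F ⊆ toFinset P) : IsSubtemplate (ofFinset F) P := by
  intro x i hi
  simpa [toFinset] using hF (mem_ofFinset.1 hi)

open Classical in
/-- The indicator of the triples of (position, color) pairs that form a rainbow 3-AP. -/
noncomputable def rainbow (x y z : Interval n × Fin r) : ℕ :=
  if IsRainbow3AP (ofFinset {x, y, z}) then 1 else 0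

theorem rainbow_swap_right (x y z : Interval n × Fin r) : rainbow x y z = rainbow x z y := by
  rw [rainbow, rainbow, Finset.pair_comm y z]

theorem rainbow_swap_left (x y z : Interval n × Fin r) : rainbow x y z = rainbow y x z := by
  rw [rainbow, rainbow, Finset.insert_comm]

theorem rainbow_eq_zero_of_free {Q : Template r n} (hQ : IsRainbow3APFree Q)
    {x y z : Interval n × Fin r} (hx : x ∈ toFinset Q) (hy : y ∈ toFinset Q)
    (hz : z ∈ toFinset Q) : rainbow x y z = 0 := by
  refine if_neg (hQ _ (ofFinset_isSubtemplate ?_))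
  simp [insert_subset_iff, hx, hy, hz]

theorem position_of_rainbow {x y z : Interval n × Fin r}
    (h : IsRainbow3AP (ofFinset {x, y, z})) :
    (x.1 + y.1 : ℕ) = 2 * z.1 ∨ (y.1 + z.1 : ℕ) = 2 * x.1 ∨ (x.1 + z.1 : ℕ) = 2 * y.1 := by
  obtain ⟨a, b, c, habc, ha, hb, hc, -, hab, hbc, hac⟩ := h
  have key : ∀ a : Interval n, (ofFinset {x, y, z} a).card = 1 → a = x.1 ∨ a = y.1 ∨ a = z.1 := by
    intro a ha
    obtain ⟨i, hi⟩ := card_pos.1 (ha ▸ Nat.one_pos)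
    have := mem_ofFinset.1 hi
    simp only [mem_insert, mem_singleton] at this
    rcases this with h | h | h <;> simp [← h]
  have hab' : a ≠ b := fun h => hab (by rw [h])
  have hbc' : b ≠ c := fun h => hbc (by rw [h])
  have hac' : a ≠ c := fun h => hac (by rw [h])
  rcases key a ha with rfl | rfl | rfl <;> rcases key b hb with h | h | h <;>
    rcases key c hc with h' | h' | h' <;> subst h <;> subst h' <;>
    first | exact absurd rfl hab' | exact absurd rfl hbc' | exact absurd rfl hac' | omega

/-- The third position is the midpoint of the other two or one of two reflections, with r colors
each. Truncated arithmetic only adds harmless candidates. -/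
theorem sum_rainbow_le (x y : Interval n × Fin r) : ∑ z, rainbow x y z ≤ 3 * r := by
  classical
  have h1 : ∑ z, rainbow x y z = (univ.filter fun z : Interval n × Fin r =>
      IsRainbow3AP (ofFinset {x, y, z})).card := by
    rw [card_filter]
    rfl
  have h2 : (univ.filter fun z : Interval n × Fin r =>
      IsRainbow3AP (ofFinset {x, y, z})).card ≤
      (({((x.1 : ℕ) + y.1) / 2, 2 * (x.1 : ℕ) - y.1, 2 * (y.1 : ℕ) - x.1} : Finset ℕ) ×ˢ
        (univ : Finset (Fin r))).card := by
    refine card_le_card_of_injOn (fun z => ((z.1 : ℕ), z.2)) ?_ ?_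
    · intro z hz
      have := position_of_rainbow (mem_filter.1 hz).2
      refine mem_coe.2 (mem_product.2 ⟨?_, mem_univ _⟩)
      rw [mem_insert, mem_insert, mem_singleton]
      dsimp only
      omega
    · intro z _ w _ h
      exact Prod.ext (Subtype.ext (Prod.mk.inj h).1) (Prod.mk.inj h).2
  rw [h1]
  refine h2.trans ?_
  rw [card_product, card_univ, Fintype.card_fin]
  exact Nat.mul_le_mul_right _ card_le_three

theorem exists_eq_ofFinset_of_isRainbow3AP {Q : Template r n} (hQ : IsRainbow3AP Q) :
    ∃ x ∈ toFinset Q, ∃ y ∈ toFinset Q, ∃ z ∈ toFinset Q, Q = ofFinset {x, y, z} := by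
  obtain ⟨a, b, c, -, ha, hb, hc, h0, hab, hbc, hac⟩ := hQ
  have hab' : a ≠ b := fun h => hab (by rw [h])
  have hbc' : b ≠ c := fun h => hbc (by rw [h])
  have hac' : a ≠ c := fun h => hac (by rw [h])
  obtain ⟨i, hi⟩ := card_eq_one.1 ha
  obtain ⟨j, hj⟩ := card_eq_one.1 hb
  obtain ⟨k, hk⟩ := card_eq_one.1 hc
  refine ⟨(a, i), by simp [toFinset, hi], (b, j), by simp [toFinset, hj],
    (c, k), by simp [toFinset, hk], ?_⟩
  funext x
  ext l
  rw [mem_ofFinset]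
  simp only [mem_insert, mem_singleton, Prod.mk.injEq]
  by_cases hxa : x = a
  · subst hxa; simp [hi, hab', hac']
  by_cases hxb : x = b
  · subst hxb; simp [hj, hxa, hbc']
  by_cases hxc : x = c
  · subst hxc; simp [hk, hxa, hxb]
  simp [hxa, hxb, hxc, card_eq_zero.1 (h0 x hxa hxb hxc)]

theorem numRainbow3AP_ofFinset_le (F : Finset (Interval n × Fin r)) :
    numRainbow3AP (ofFinset F) ≤ ∑ x ∈ F, ∑ y ∈ F, ∑ z ∈ F, rainbow x y z := by
  classical
  set T : Finset ((Interval n × Fin r) × (Interval n × Fin r) × (Interval n × Fin r)) :=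
    (F ×ˢ F ×ˢ F).filter fun t => IsRainbow3AP (ofFinset {t.1, t.2.1, t.2.2}) with hT
  have h1 : ∑ x ∈ F, ∑ y ∈ F, ∑ z ∈ F, rainbow x y z = T.card := by
    rw [hT, card_filter, sum_product]
    refine sum_congr rfl fun x _ => ?_
    rw [sum_product]
    rfl
  rw [h1, numRainbow3AP]
  calc _ ≤ Set.ncard (↑(T.image fun t => (ofFinset {t.1, t.2.1, t.2.2} : Template r n)) :
        Set (Template r n)) := by
        refine Set.ncard_le_ncard ?_ (Set.toFinite _)
        rintro Q ⟨hQF, hQ⟩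
        obtain ⟨x, hx, y, hy, z, hz, h⟩ := exists_eq_ofFinset_of_isRainbow3AP hQ
        have hsub := isSubtemplate_ofFinset.1 hQF
        refine mem_coe.2 (mem_image.2 ⟨(x, y, z), mem_filter.2 ⟨?_, h ▸ hQ⟩, h.symm⟩)
        exact mem_product.2 ⟨hsub hx, mem_product.2 ⟨hsub hy, hsub hz⟩⟩
    _ ≤ T.card := by rw [Set.ncard_coe_finset]; exact card_image_le

theorem sq_le_num3AP (hn : 12 ≤ n) : n ^ 2 ≤ 16 * num3AP n := by
  have h1 : (n / 3) * (n / 3) ≤ num3AP n := by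
    have h2 : (Icc 1 (n / 3) ×ˢ Icc 1 (n / 3)).card ≤ num3AP n := by
      -- The pair is (first term, difference), so the last term is at most n. The default value
      -- outside the box is never used.
      refine card_le_card_of_injOn (fun p : ℕ × ℕ =>
        if h : p.1 ∈ Icc 1 (n / 3) ∧ p.2 ∈ Icc 1 (n / 3) then
          ((⟨p.1, by simp only [mem_Icc] at h ⊢; omega⟩,
            ⟨p.1 + p.2, by simp only [mem_Icc] at h ⊢; omega⟩,
            ⟨p.1 + 2 * p.2, by simp only [mem_Icc] at h ⊢; omega⟩) :
              Interval n × Interval n × Interval n)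
        else (⟨1, by simp only [mem_Icc]; omega⟩, ⟨1, by simp only [mem_Icc]; omega⟩,
          ⟨1, by simp only [mem_Icc]; omega⟩)) ?_ ?_
      · intro p hp
        have hp' := mem_product.1 hp
        simp only [hp', and_self, dif_pos]
        simp only [mem_Icc] at hp'
        simp only [coe_filter, mem_univ, true_and, Set.mem_ofPred_eq]
        omega
      · intro p hp q hq h
        have hp' := mem_product.1 hp
        have hq' := mem_product.1 hq
        simp only [hp', hq', and_self, dif_pos, Prod.mk.injEq, Subtype.mk.injEq] at h
        ext <;> omega
    simpa using h2
  have h3 : n ≤ 4 * (n / 3) := by omega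
  nlinarith

theorem card_vertices : Fintype.card (Interval n × Fin r) = r * n := by
  rw [Fintype.card_prod, Fintype.card_fin, Fintype.card_coe, Nat.card_Icc, mul_comm]
  simp

/-! ### Parameters and containers for templates -/

/-- Parameters for which the container theorem gives the required bounds. -/
theorem exists_parameters (hr : 1 ≤ r) :
    ∃ n₀ c₁ : ℕ, ∀ n ≥ n₀, ∃ m A B D P : ℕ, 0 < B ∧ 0 < D ∧ m ^ 3 ≤ n ∧
      3 * (B + 3 * r) * (r * n) ≤ D * A ∧ 3 * r * (r * n) ≤ B * P ∧
      16 * (r * D + 9 * r ^ 2 * A) ≤ m ^ 2 ∧ A + P ≤ c₁ * m ^ 2 := by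
  -- With D = A = 7680 r³ m z, the bound W z ≤ m gives 160 r² D ≤ m², while 48 · 160 = 7680 gives 24
  -- r z m² · 2 W z = D A.
  set W : ℕ := 160 * r ^ 2 * (7680 * r ^ 3) with hW
  have hWpos : 0 < W := by positivity
  -- This threshold forces z ≥ 6r, so that B = z - 3r is at least z/2.
  refine ⟨(W * (6 * r)) ^ 3, 1 + 96 * r ^ 2 * W, fun n hn => ?_⟩
  obtain ⟨m, hm, hm'⟩ : ∃ m, m ^ 3 ≤ n ∧ n < (m + 1) ^ 3 := by
    have h0 : ∃ k, n < (k + 1) ^ 3 := ⟨n, by nlinarith [Nat.zero_le (n ^ 3), Nat.zero_le (n ^ 2)]⟩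
    classical
    refine ⟨Nat.find h0, ?_, Nat.find_spec h0⟩
    by_contra! hlt
    rcases hk : Nat.find h0 with _ | k
    · simp [hk] at hlt
    · exact Nat.find_min h0 (m := k) (by omega) (by rwa [hk] at hlt)
  have hmW : W * (6 * r) ≤ m := by
    have := lt_of_pow_lt_pow_left₀ 3 (Nat.zero_le _) (hn.trans_lt hm')
    omega
  have hm1 : 1 ≤ m := (Nat.mul_pos hWpos (by omega)).trans_le hmW
  have hn8 : n ≤ 8 * m ^ 3 := by
    calc n ≤ (m + 1) ^ 3 := hm'.le
      _ ≤ (2 * m) ^ 3 := Nat.pow_le_pow_left (by omega) 3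
      _ = _ := by ring
  obtain ⟨z, hz1, hz2⟩ : ∃ z, W * z ≤ m ∧ m < W * (z + 1) :=
    ⟨m / W, Nat.mul_div_le _ _, Nat.lt_mul_div_succ m hWpos⟩
  have hz6 : 6 * r ≤ z := by
    have := lt_of_mul_lt_mul_left (hmW.trans_lt hz2) (Nat.zero_le _)
    omega
  have hz0 : 0 < z := by omega
  have hm2 : m ≤ 2 * W * z := by nlinarith
  have hX : 160 * r ^ 2 * (m * (7680 * r ^ 3 * z)) ≤ m ^ 2 := by
    calc _ = m * (W * z) := by rw [hW]; ring
      _ ≤ m * m := Nat.mul_le_mul_left _ hz1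
      _ = _ := by ring
  obtain ⟨B, hB⟩ : ∃ B, z = B + 3 * r := ⟨z - 3 * r, by omega⟩
  refine ⟨m, m * (7680 * r ^ 3 * z), B, m * (7680 * r ^ 3 * z), 96 * r ^ 2 * W * m ^ 2,
    by omega, by positivity, hm, ?_, ?_, ?_, ?_⟩
  · rw [← hB]
    calc 3 * z * (r * n) ≤ 3 * z * (r * (8 * m ^ 3)) := by gcongr
      _ = 24 * r * z * m ^ 2 * m := by ring
      _ ≤ 24 * r * z * m ^ 2 * (2 * W * z) := by gcongr
      _ = _ := by rw [hW]; ring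
  · have hzB : z ≤ 2 * B := by omega
    calc 3 * r * (r * n) ≤ 3 * r * (r * (8 * m ^ 3)) := by gcongr
      _ = 24 * r ^ 2 * m ^ 2 * m := by ring
      _ ≤ 24 * r ^ 2 * m ^ 2 * (2 * W * z) := by gcongr
      _ ≤ 24 * r ^ 2 * m ^ 2 * (2 * W * (2 * B)) := by gcongr
      _ = _ := by ring
  · refine le_trans ?_ hX
    have : r ≤ r ^ 2 := Nat.le_self_pow two_ne_zero r
    calc _ = 16 * (r + 9 * r ^ 2) * (m * (7680 * r ^ 3 * z)) := by ring
      _ ≤ 16 * (r ^ 2 + 9 * r ^ 2) * (m * (7680 * r ^ 3 * z)) := by gcongr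
      _ = _ := by ring
  · have : m * (7680 * r ^ 3 * z) ≤ m ^ 2 := by
      refine le_trans ?_ hX
      exact Nat.le_mul_of_pos_left _ (by positivity)
    linarith

theorem exists_containers_of_large (hr : 1 ≤ r) :
    ∃ n₀ c₁ : ℕ, ∀ n ≥ n₀, ∃ (m : ℕ) (C : Finset (Template r n)), m ^ 3 ≤ n ∧
      (∀ Q : Template r n, IsRainbow3APFree Q → ∃ P ∈ C, IsSubtemplate Q P) ∧
      (∀ P ∈ C, numRainbow3AP P * n ≤ m ^ 2 * num3AP n) ∧
      C.card ≤ (2 * (r * n) + 1) ^ (c₁ * m ^ 2) := by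
  classical
  obtain ⟨n₀, c₁, h⟩ := exists_parameters hr
  refine ⟨max n₀ 12, c₁, fun n hn => ?_⟩
  obtain ⟨m, A, B, D, P, hB, hD, hm, hA, hP, hDA, hc⟩ := h n (le_of_max_le_left hn)
  rw [← card_vertices (r := r) (n := n)] at hA hP
  obtain ⟨𝓕, h𝓕, hI, hF⟩ := HypergraphContainer.exists_containers (h := rainbow (r := r) (n := n))
    rainbow_swap_right rainbow_swap_left sum_rainbow_le hD hB hA hP
  rw [card_vertices] at h𝓕 hF
  refine ⟨m, 𝓕.image ofFinset, hm, fun Q hQ => ?_, fun P hP => ?_, ?_⟩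
  · obtain ⟨F, hF𝓕, hQF⟩ := hI (toFinset Q) fun x hx y hy z hz => rainbow_eq_zero_of_free hQ hx hy hz
    exact ⟨_, mem_image_of_mem _ hF𝓕, isSubtemplate_ofFinset.2 hQF⟩
  · obtain ⟨F, hF𝓕, rfl⟩ := mem_image.1 hP
    have h1 := (numRainbow3AP_ofFinset_le F).trans (hF F hF𝓕)
    have h2 := sq_le_num3AP (le_of_max_le_right hn)
    refine Nat.le_of_mul_le_mul_left ?_ (show 0 < 16 by norm_num)
    calc 16 * (numRainbow3AP (ofFinset F) * n)
        ≤ 16 * ((r * n * D + 3 * A * (3 * r) * (r * n)) * n) := by gcongr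
      _ = 16 * (r * D + 9 * r ^ 2 * A) * n ^ 2 := by ring
      _ ≤ m ^ 2 * (16 * num3AP n) := Nat.mul_le_mul hDA h2
      _ = _ := by ring
  · exact card_image_le.trans (h𝓕.trans (Nat.pow_le_pow_right (by omega) hc))

theorem card_template : Fintype.card (Template r n) = 2 ^ (r * n) := by
  simp [Template, ← pow_mul]

/-- Serves n below the threshold, where rn is absorbed into the constant. -/
theorem exists_containers_of_free :
    ∃ C : Finset (Template r n),
      (∀ Q : Template r n, IsRainbow3APFree Q → ∃ P ∈ C, IsSubtemplate Q P) ∧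
      (∀ P ∈ C, numRainbow3AP P = 0) ∧ C.card ≤ 2 ^ (r * n) := by
  classical
  refine ⟨univ.filter IsRainbow3APFree, fun Q hQ => ⟨Q, by simpa using hQ, fun x => subset_rfl⟩,
    fun P hP => ?_, (card_filter_le _ _).trans (card_template (r := r) (n := n)).le⟩
  rw [numRainbow3AP, Set.ncard_eq_zero (Set.toFinite _)]
  exact Set.eq_empty_of_forall_notMem fun Q hQ => (mem_filter.1 hP).2 Q hQ.1 hQ.2

/-- For n = 1 the bound in (iii) is 0, so a single container has to suffice. -/
theorem exists_containers_one :
    ∃ C : Finset (Template r 1),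
      (∀ Q : Template r 1, IsRainbow3APFree Q → ∃ P ∈ C, IsSubtemplate Q P) ∧
      (∀ P ∈ C, numRainbow3AP P = 0) ∧ C.card = 1 := by
  refine ⟨{fun _ => univ}, fun Q _ => ⟨_, mem_singleton_self _, fun x => subset_univ _⟩,
    fun P _ => ?_, card_singleton _⟩
  rw [numRainbow3AP, Set.ncard_eq_zero (Set.toFinite _)]
  refine Set.eq_empty_of_forall_notMem fun Q hQ => ?_
  obtain ⟨a, b, -, -, -, -, -, -, hab, -⟩ := hQ.2
  have ha := mem_Icc.1 a.2
  have hb := mem_Icc.1 b.2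
  exact hab (congrArg Q (Subtype.ext (by omega)))

end RainbowAP

/-! ### Passage to real exponents and logarithms -/

theorem mainTheorem7 (r : ℕ) (hr : 3 ≤ r) :
    ∃ c : ℝ, 0 < c ∧ ∀ n : ℕ, 1 ≤ n →
      ∃ C : Finset (RainbowAP.Template r n),
        (∀ Q : RainbowAP.Template r n, RainbowAP.IsRainbow3APFree Q →
          ∃ P ∈ C, RainbowAP.IsSubtemplate Q P) ∧
        (∀ P ∈ C, (RainbowAP.numRainbow3AP P : ℝ) ≤
          (n : ℝ) ^ (-(1 / 3) : ℝ) * (RainbowAP.num3AP n : ℝ)) ∧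
        Real.logb 2 (C.card : ℝ) ≤ c * (n : ℝ) ^ (2 / 3 : ℝ) * Real.logb 2 (n : ℝ) ^ 2 := by
  obtain ⟨n₀, c₁, hlarge⟩ := RainbowAP.exists_containers_of_large (r := r) (by omega)
  have hL0 : 0 ≤ Real.logb 2 (3 * r : ℝ) :=
    Real.logb_nonneg one_lt_two (by norm_cast; omega)
  -- The summands serve small n, large n and positivity, respectively.
  refine ⟨r * n₀ + c₁ * (Real.logb 2 (3 * r : ℝ) + 1) + 1, by positivity, fun n hn => ?_⟩
  have hn0 : (0 : ℝ) < n := by exact_mod_cast hn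
  have hn1 : (1 : ℝ) ≤ n := by exact_mod_cast hn
  have hpow : (1 : ℝ) ≤ (n : ℝ) ^ (2 / 3 : ℝ) := Real.one_le_rpow hn1 (by norm_num)
  rcases hn.eq_or_lt with rfl | hn2
  · obtain ⟨C, hC, hC0, hC1⟩ := RainbowAP.exists_containers_one (r := r)
    exact ⟨C, hC, fun P hP => by rw [hC0 P hP]; simp, by simp [hC1]⟩
  have hlog : 1 ≤ Real.logb 2 (n : ℝ) := by
    rw [Real.le_logb_iff_rpow_le one_lt_two hn0]
    norm_num
    exact_mod_cast hn2
  have hlog2 : Real.logb 2 (n : ℝ) ≤ Real.logb 2 (n : ℝ) ^ 2 := by nlinarith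
  rcases lt_or_ge n n₀ with hlt | hge
  · obtain ⟨C, hC, hC0, hC1⟩ := RainbowAP.exists_containers_of_free (r := r) (n := n)
    refine ⟨C, hC, fun P hP => by rw [hC0 P hP, Nat.cast_zero]; positivity, ?_⟩
    have h1 : Real.logb 2 (C.card : ℝ) ≤ r * n := by
      rcases Nat.eq_zero_or_pos C.card with h0 | h0
      · rw [h0, Nat.cast_zero, Real.logb_zero]; positivity
      · rw [Real.logb_le_iff_le_rpow one_lt_two (by exact_mod_cast h0)]
        exact_mod_cast hC1
    have h2 : (r * n : ℝ) ≤ r * n₀ := by gcongr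
    have h3 : (r * n₀ : ℝ) ≤ r * n₀ + c₁ * (Real.logb 2 (3 * r : ℝ) + 1) + 1 := by
      have : 0 ≤ c₁ * (Real.logb 2 (3 * r : ℝ) + 1) := by positivity
      linarith
    calc _ ≤ (r * n₀ + c₁ * (Real.logb 2 (3 * r : ℝ) + 1) + 1) * 1 * 1 := by linarith
      _ ≤ _ := by gcongr; exact hlog.trans hlog2
  · obtain ⟨m, C, hm, hC, hR, hcard⟩ := hlarge n hge
    have hmn : (m : ℝ) ^ 2 ≤ (n : ℝ) ^ (2 / 3 : ℝ) := by
      calc (m : ℝ) ^ 2 = ((m : ℝ) ^ 3) ^ (2 / 3 : ℝ) := by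
            rw [← Real.rpow_natCast, ← Real.rpow_natCast, ← Real.rpow_mul (Nat.cast_nonneg m)]
            norm_num
        _ ≤ _ := Real.rpow_le_rpow (by positivity) (by exact_mod_cast hm) (by norm_num)
    refine ⟨C, hC, fun P hP => ?_, ?_⟩
    · have h1 : (RainbowAP.numRainbow3AP P * n : ℝ) ≤ m ^ 2 * RainbowAP.num3AP n := by
        exact_mod_cast hR P hP
      have h2 : (n : ℝ) ^ (-(1 / 3) : ℝ) * n = (n : ℝ) ^ (2 / 3 : ℝ) := by
        nth_rewrite 2 [← Real.rpow_one (n : ℝ)]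
        rw [← Real.rpow_add hn0]
        norm_num
      refine le_of_mul_le_mul_right ?_ hn0
      calc _ ≤ (m : ℝ) ^ 2 * RainbowAP.num3AP n := h1
        _ ≤ (n : ℝ) ^ (2 / 3 : ℝ) * RainbowAP.num3AP n := by gcongr
        _ = _ := by rw [← h2]; ring
    · have h1 : Real.logb 2 (C.card : ℝ) ≤ (c₁ * m ^ 2) * Real.logb 2 (3 * r * n) := by
        rcases Nat.eq_zero_or_pos C.card with h0 | h0
        · rw [h0]
          have : 0 ≤ Real.logb 2 (3 * r * n : ℝ) := Real.logb_nonneg one_lt_two (by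
            norm_cast; nlinarith)
          simp only [Nat.cast_zero, Real.logb_zero]
          positivity
        · have h2 : C.card ≤ (3 * r * n) ^ (c₁ * m ^ 2) :=
            hcard.trans (Nat.pow_le_pow_left (by nlinarith) _)
          have h3 : (C.card : ℝ) ≤ (3 * r * n : ℝ) ^ (c₁ * m ^ 2) := by exact_mod_cast h2
          refine (Real.logb_le_logb_of_le one_lt_two (by exact_mod_cast h0) h3).trans ?_
          rw [Real.logb_pow]
          push_cast
          exact le_rfl
      have h2 : Real.logb 2 (3 * r * n : ℝ) =
          Real.logb 2 (3 * r : ℝ) + Real.logb 2 (n : ℝ) :=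
        Real.logb_mul (by positivity) hn0.ne'
      -- A single factor log n would suffice; the square is slack.
      have h3 : Real.logb 2 (3 * r * n : ℝ) ≤
          (Real.logb 2 (3 * r : ℝ) + 1) * Real.logb 2 (n : ℝ) ^ 2 := by
        rw [h2]
        nlinarith
      calc _ ≤ (c₁ * m ^ 2) * Real.logb 2 (3 * r * n) := h1
        _ ≤ (c₁ * (n : ℝ) ^ (2 / 3 : ℝ)) *
            ((Real.logb 2 (3 * r : ℝ) + 1) * Real.logb 2 (n : ℝ) ^ 2) := by
          have := h2 ▸ add_nonneg hL0 (zero_le_one.trans hlog)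
          gcongr
        -- The zeros match the shape of the constant, so that `gcongr` compares summand by summand.
        _ = (0 + c₁ * (Real.logb 2 (3 * r : ℝ) + 1) + 0) * (n : ℝ) ^ (2 / 3 : ℝ) *
            Real.logb 2 (n : ℝ) ^ 2 := by ring
        _ ≤ _ := by
          gcongr
          · positivity
          · exact zero_le_one
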